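/- Let $c\in\mathbb{C}$, let $\mathrm{Vir}^c$ be the universal Virasoro vertex algebra of central charge $c$, with conformal vector $L=L_{-2}|0\rangle$ and $Y(L,z)=\sum_{n\in\mathbb{Z}}L_nz^{-n-2}$, and let $\Gamma\subset\mathbb{C}$ satisfy $\Gamma+\mathbb{Z}=\Gamma$ with $\Gamma/\mathbb{Z}$ finite. A $\mathrm{Vir}^c$-module is a complex vector space $M$ with $T\in\mathrm{End}(M)$ and a linear map $v\mapsto Y^M(v,z)=\sum_{n\in\mathbb{Z}}v_{(n)}z^{-n-1}\in\mathrm{Hom}(M,M((z)))$ satisfying $Y^M(|0\rangle,z)=I_M$, $[T,Y^M(v,z)]=\partial_zY^M(v,z)$ and the Borcherds identity; write $L_n=L_{(n+1)}$ and $[v_\lambda a]=\sum_{n\ge 0}\frac{\lambda^n}{n!}v_{(n)}a\in M[\lambda]$ for $v\in\mathrm{Vir}^c$, $a\in M$. A vector $a\in M$ is primary of weight $h\in\mathbb{C}$ if $$[L_\lambda a]=(T+h\lambda)a,$$ equivalently if $L_na=0$ for all $n>0$, $L_0a=ha$ and $L_{-1}a=Ta$ (the last condition being automatic when $T=L_{-1}$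 on $M$). Let $M_1,M_2,M_3$ be $\mathrm{Vir}^c$-modules and let $\mathcal{Y}$ be an intertwining operator of type $\binom{M_3}{M_1\ M_2}$, $\mathcal{Y}(a,z)b=\sum_{k\in\mathbb{C}}a_{(k)}b\,z^{-k-1}\in M_3[[z]]z^{-\Gamma}$, i.e. $\mathcal{Y}$ is bilinear, $[T,\mathcal{Y}(a,z)]=\mathcal{Y}(Ta,z)=\partial_z\mathcal{Y}(a,z)$, and for all $v\in\mathrm{Vir}^c$, $a\in M_1$, $b\in M_2$, $n,m\in\mathbb{Z}$, $k\in\mathbb{C}$ $$\sum_{j\ge 0}(-1)^j\binom nj\bigl(v_{(m+n-j)}a_{(k+j)}b-(-1)^na_{(n+k-j)}v_{(m+j)}b\bigr)=\sum_{j\ge 0}\binom mj(v_{(n+j)}a)_{(m+k-j)}b .$$ Let $a\in M_1$ and $b\in M_2$ be primary vectors of weights $h_a$ and $h_b$, and let $m_1,\dots,m_d\in\mathbb{C}$ be pairwise incongruent modulo $\mathbb{Z}$ and such that $$\mathcal{Y}(a,z)b=\sum_{i=1}^d\sum_{n\ge 0}a_{(m_i-n)}b\,z^{-m_i+n-1}.$$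 Then for every $i$, with $h_c\in\mathbb{C}$ defined by $m_i=h_a+h_b-1-h_c$, the vector $a_{(m_i)}b\in M_3$ is primary of weight $h_c$: $$[L_\lambda\, a_{(m_i)}b]=(\lambda h_c+T)\,a_{(m_i)}b ,$$ and in particular $L_n\,a_{(m_i)}b=0$ for all $n>0$ and $L_0\,a_{(m_i)}b=h_c\,a_{(m_i)}b$. -/

import Mathlib

noncomputable section

/-- `(-1)ʲ (n choose j)`, the coefficient of `xⁿ⁻ʲ yʲ` in the expansion of `(x - y)ⁿ`, `n ∈ ℤ`, in
nonnegative powers of `y`. -/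
def signedChoose (n : ℤ) (j : ℕ) : ℂ := (-1) ^ j * ((Ring.choose n j : ℤ) : ℂ)

theorem signedChoose_zero_right (n : ℤ) : signedChoose n 0 = 1 := by simp [signedChoose]

theorem signedChoose_zero_left (j : ℕ) : signedChoose 0 j = if j = 0 then 1 else 0 := by
  cases j <;> simp [signedChoose, Ring.choose_zero_succ]

theorem sub_mul_signedChoose (n : ℤ) (j : ℕ) :
    ((n : ℂ) - j) * signedChoose n j = n * signedChoose (n - 1) j := by
  have h1 := Ring.choose_smul_choose n (n := j + 1) (k := j) (by omega)
  have h2 := Ring.choose_smul_choose n (n := j + 1) (k := 1) (by omega)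
  simp only [Nat.choose_succ_self_right, Nat.choose_one_right, Nat.add_sub_cancel_left,
    Nat.add_sub_cancel, Ring.choose_one_right, Nat.cast_one] at h1 h2
  have h3 : ((Ring.choose n j * (n - j) : ℤ) : ℂ) = ((n * Ring.choose (n - 1) j : ℤ) : ℂ) := by
    rw [← h1, ← h2]
  push_cast at h3
  unfold signedChoose
  linear_combination (-1) ^ j * h3

theorem signedChoose_succ (n : ℤ) (j : ℕ) :
    signedChoose n (j + 1) = signedChoose (n - 1) (j + 1) - signedChoose (n - 1) j := by
  have h := Ring.choose_succ_succ (n - 1) j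
  rw [sub_add_cancel] at h
  unfold signedChoose
  rw [h]; push_cast; ring

open Finset in
theorem sum_signedChoose (p q : ℤ) (s : ℕ) :
    ∑ x ∈ antidiagonal s, signedChoose p x.1 * signedChoose q x.2 = signedChoose (p + q) s := by
  unfold signedChoose
  rw [Ring.add_choose_eq s (Commute.all p q)]
  push_cast
  rw [mul_sum]
  refine sum_congr rfl fun x hx => ?_
  rw [← mem_antidiagonal.1 hx, pow_add]; ring

open Finset in
theorem sum_signedChoose_sub (p q : ℤ) (s : ℕ) :
    ∑ x ∈ antidiagonal s, signedChoose p x.1 * signedChoose q x.2 *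
      (((p : ℂ) - x.1) - ((q : ℂ) - x.2)) = ((p : ℂ) - q) * signedChoose (p + q - 1) s := by
  have h1 := sum_signedChoose (p - 1) q s
  have h2 := sum_signedChoose p (q - 1) s
  rw [show p - 1 + q = p + q - 1 by ring] at h1
  rw [show p + (q - 1) = p + q - 1 by ring] at h2
  rw [sub_mul]
  nth_rewrite 1 [← h1]
  rw [← h2, mul_sum, mul_sum, ← sum_sub_distrib]
  refine sum_congr rfl fun x _ => ?_
  linear_combination signedChoose q x.2 * sub_mul_signedChoose p x.1 -
    signedChoose p x.1 * sub_mul_signedChoose q x.2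

open Finset in
theorem sum_signedChoose_cubic (p q : ℤ) (s : ℕ) :
    ∑ x ∈ antidiagonal s, signedChoose p x.1 * signedChoose q x.2 *
      (((p : ℂ) - x.1) * ((p : ℂ) - x.1 - 1) * ((p : ℂ) - x.1 - 2)) =
      (p : ℂ) * (p - 1) * (p - 2) * signedChoose (p + q - 3) s := by
  have h1 := sum_signedChoose (p - 3) q s
  rw [show p - 3 + q = p + q - 3 by ring] at h1
  rw [← h1, mul_sum]
  refine sum_congr rfl fun x _ => ?_
  have e1 := sub_mul_signedChoose p x.1
  have e2 := sub_mul_signedChoose (p - 1) x.1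
  have e3 := sub_mul_signedChoose (p - 2) x.1
  rw [show p - 1 - 1 = p - 2 by ring] at e2
  rw [show p - 2 - 1 = p - 3 by ring] at e3
  push_cast at e1 e2 e3
  linear_combination signedChoose q x.2 * (((p : ℂ) - x.1 - 1) * ((p : ℂ) - x.1 - 2) * e1 +
    p * ((p : ℂ) - x.1 - 2) * e2 + p * (p - 1) * e3)

open Finset in
theorem sum_signedChoose_diff (p q : ℤ) (s : ℕ) :
    ∑ x ∈ antidiagonal (s + 1), signedChoose p x.1 * signedChoose q x.2 * ((x.2 : ℂ) - x.1) =
      ((p : ℂ) - q) * signedChoose (p + q - 1) s := by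
  have h1 := sum_signedChoose_sub p q (s + 1)
  have h2 := sum_signedChoose p q (s + 1)
  rw [signedChoose_succ (p + q)] at h2
  have : ∀ x : ℕ × ℕ, signedChoose p x.1 * signedChoose q x.2 * ((x.2 : ℂ) - x.1) =
    signedChoose p x.1 * signedChoose q x.2 * (((p : ℂ) - x.1) - ((q : ℂ) - x.2)) -
      ((p : ℂ) - q) * (signedChoose p x.1 * signedChoose q x.2) := fun x => by ring
  simp only [this, sum_sub_distrib, ← mul_sum, h1, h2]
  ring

section Fields

open scoped VertexOperator

variable {V : Type*} [AddCommGroup V] [Module ℂ V]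

theorem exists_ncoeff_eq_zero (A : VertexOperator ℂ V) (w : V) :
    ∃ N : ℕ, ∀ n : ℤ, N ≤ n → (A[[n]]) w = 0 := by
  refine ⟨(-HahnSeries.order ((HahnModule.of ℂ).symm (A w))).toNat, fun n hn => ?_⟩
  apply VertexOperator.ncoeff_eq_zero_of_lt_order
  omega

theorem finsum_nat_eq_sum {W : Type*} [AddCommGroup W] {f : ℕ → W} (N : ℕ) (h : ∀ j, N ≤ j → f j = 0) :
    ∑ᶠ j, f j = ∑ j ∈ Finset.range N, f j := by
  refine finsum_eq_sum_of_support_subset _ fun j hj => ?_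
  by_contra hc
  exact hj (h j (by simpa using hc))

/-- The coefficient of `z₂⁻ᵏ⁻¹` in the `m`-th product of two fields, applied to `w`. -/
def fieldProductCoeff (A B : VertexOperator ℂ V) (m k : ℤ) (w : V) : V :=
  (∑ᶠ j : ℕ, signedChoose m j • (A[[m - j]]) ((B[[k + j]]) w)) -
    (-1 : ℂ) ^ m • ∑ᶠ j : ℕ, signedChoose m j • (B[[m + k - j]]) ((A[[(j : ℤ)]]) w)

theorem fieldProductCoeff_eq_sum {A B : VertexOperator ℂ V} {m k : ℤ} {w : V} (R : ℕ)
    (hB : ∀ j : ℕ, R ≤ j → (B[[k + j]]) w = 0) (hA : ∀ j : ℕ, R ≤ j → (A[[(j : ℤ)]]) w = 0) :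
    fieldProductCoeff A B m k w =
      (∑ j ∈ Finset.range R, signedChoose m j • (A[[m - j]]) ((B[[k + j]]) w)) -
    (-1 : ℂ) ^ m • ∑ j ∈ Finset.range R,
      signedChoose m j • (B[[m + k - j]]) ((A[[(j : ℤ)]]) w) := by
  rw [fieldProductCoeff, finsum_nat_eq_sum R, finsum_nat_eq_sum R]
  · intro j hj; rw [hA j hj]; simp
  · intro j hj; rw [hB j hj]; simp

theorem exists_bound₁ (A B : VertexOperator ℂ V) (w : V) :
    ∃ N : ℕ, (∀ n : ℤ, N ≤ n → (A[[n]]) w = 0) ∧ (∀ n : ℤ, N ≤ n → (B[[n]]) w = 0) ∧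
      ∀ j : ℕ, ∀ n : ℤ, N ≤ n → (B[[n]]) ((A[[(j : ℤ)]]) w) = 0 := by
  obtain ⟨N₁, h₁⟩ := exists_ncoeff_eq_zero A w
  obtain ⟨N₂, h₂⟩ := exists_ncoeff_eq_zero B w
  choose f hf using fun j : ℕ => exists_ncoeff_eq_zero B ((A[[(j : ℤ)]]) w)
  refine ⟨N₁ + N₂ + ∑ j ∈ Finset.range N₁, f j, fun n hn => h₁ n (by omega),
    fun n hn => h₂ n (by omega), fun j n hn => ?_⟩
  by_cases hj : j < N₁
  · have := Finset.single_le_sum (f := f) (fun i _ => Nat.zero_le _) (Finset.mem_range.2 hj)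
    exact hf j n (by omega)
  · rw [h₁ j (by omega), map_zero]

theorem fieldProductCoeff_add (A B : VertexOperator ℂ V) (m k : ℤ) (v w : V) :
    fieldProductCoeff A B m k (v + w) =
      fieldProductCoeff A B m k v + fieldProductCoeff A B m k w := by
  obtain ⟨N₁, a₁, b₁, -⟩ := exists_bound₁ A B v
  obtain ⟨N₂, a₂, b₂, -⟩ := exists_bound₁ A B w
  rw [fieldProductCoeff_eq_sum (N₁ + N₂ + k.natAbs) (w := v),
    fieldProductCoeff_eq_sum (N₁ + N₂ + k.natAbs) (w := w),
    fieldProductCoeff_eq_sum (N₁ + N₂ + k.natAbs) (w := v + w)]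
  · simp only [map_add, smul_add, Finset.sum_add_distrib]
    abel
  · intro j hj; rw [map_add, b₁ _ (by omega), b₂ _ (by omega), add_zero]
  · intro j hj; rw [map_add, a₁ _ (by omega), a₂ _ (by omega), add_zero]
  · intro j hj; exact b₂ _ (by omega)
  · intro j hj; exact a₂ _ (by omega)
  · intro j hj; exact b₁ _ (by omega)
  · intro j hj; exact a₁ _ (by omega)

theorem fieldProductCoeff_smul (A B : VertexOperator ℂ V) (m k : ℤ) (r : ℂ) (w : V) :
    fieldProductCoeff A B m k (r • w) = r • fieldProductCoeff A B m k w := by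
  obtain ⟨N, a, b, -⟩ := exists_bound₁ A B w
  rw [fieldProductCoeff_eq_sum (N + k.natAbs) (w := w),
    fieldProductCoeff_eq_sum (N + k.natAbs) (w := r • w)]
  · simp only [map_smul, smul_sub, Finset.smul_sum, smul_comm r]
  · intro j hj; rw [map_smul, b _ (by omega), smul_zero]
  · intro j hj; rw [map_smul, a _ (by omega), smul_zero]
  · intro j hj; exact b _ (by omega)
  · intro j hj; exact a _ (by omega)

theorem exists_fieldProductCoeff_eq_zero (A B : VertexOperator ℂ V) (m : ℤ) (w : V) :
    ∃ N : ℕ, ∀ k : ℤ, N ≤ k → fieldProductCoeff A B m k w = 0 := by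
  obtain ⟨N, a, b, c⟩ := exists_bound₁ A B w
  refine ⟨2 * N + m.natAbs, fun k hk => ?_⟩
  rw [fieldProductCoeff_eq_sum N]
  · rw [Finset.sum_eq_zero, Finset.sum_eq_zero]
    · simp
    · intro j hj
      have := Finset.mem_range.1 hj
      rw [c j _ (by omega), smul_zero]
    · intro j _
      rw [b _ (by omega), map_zero, smul_zero]
  · intro j hj; exact b _ (by omega)
  · intro j hj; exact a _ (by omega)

/-- The `m`-th product of two fields,
`A(z₂)₍ₘ₎B(z₂) = Res_{z₁} (ι_{z₁,z₂}(z₁-z₂)ᵐ A(z₁)B(z₂) - ι_{z₂,z₁}(z₁-z₂)ᵐ B(z₂)A(z₁))`.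
For `m = -n-1` with `n ≥ 0` this is the normally ordered product `:∂⁽ⁿ⁾A(z) B(z):`. -/
def fieldProduct (A B : VertexOperator ℂ V) (m : ℤ) : VertexOperator ℂ V :=
  VertexOperator.of_coeff
    (fun n =>
      { toFun := fieldProductCoeff A B m (-n - 1)
        map_add' := fieldProductCoeff_add A B m (-n - 1)
        map_smul' := fieldProductCoeff_smul A B m (-n - 1) })
    (fun w => by
      obtain ⟨N, hN⟩ := exists_fieldProductCoeff_eq_zero A B m w
      refine ⟨-N, fun n hn => ?_⟩
      by_contra hc
      exact hn (hN _ (by omega)))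

theorem fieldProduct_ncoeff (A B : VertexOperator ℂ V) (m k : ℤ) (w : V) :
    ((fieldProduct A B m)[[k]]) w = fieldProductCoeff A B m k w := by
  rw [fieldProduct, VertexOperator.ncoeff_of_coeff]
  simp

theorem vertexOperator_ext {A B : VertexOperator ℂ V} (h : ∀ k w, (A[[k]]) w = (B[[k]]) w) :
    A = B := by
  refine HVertexOperator.coeff_inj (funext fun n => LinearMap.ext fun w => ?_)
  have := h (-n - 1) w
  rwa [VertexOperator.ncoeff_apply, VertexOperator.ncoeff_apply,
    show -(-n - 1) - 1 = n by ring] at this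

/-- The `m`-th product `A₍ₘ₎B` as a linear map in `B`. -/
def fieldProductHom (A : VertexOperator ℂ V) (m : ℤ) : Module.End ℂ (VertexOperator ℂ V) where
  toFun B := fieldProduct A B m
  map_add' B B' := by
    refine vertexOperator_ext fun k w => ?_
    rw [map_add, Pi.add_apply, LinearMap.add_apply]
    simp only [fieldProduct_ncoeff]
    obtain ⟨N₁, a, b₁, -⟩ := exists_bound₁ A B w
    obtain ⟨N₂, -, b₂, -⟩ := exists_bound₁ A B' w
    rw [fieldProductCoeff_eq_sum (N₁ + N₂ + k.natAbs) (B := B),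
      fieldProductCoeff_eq_sum (N₁ + N₂ + k.natAbs) (B := B'),
      fieldProductCoeff_eq_sum (N₁ + N₂ + k.natAbs) (B := B + B')]
    · simp only [map_add, Pi.add_apply, LinearMap.add_apply, smul_add, Finset.sum_add_distrib]
      abel
    · intro j hj
      rw [map_add, Pi.add_apply, LinearMap.add_apply, b₁ _ (by omega), b₂ _ (by omega), add_zero]
    · intro j hj; exact a _ (by omega)
    · intro j hj; exact b₂ _ (by omega)
    · intro j hj; exact a _ (by omega)
    · intro j hj; exact b₁ _ (by omega)
    · intro j hj; exact a _ (by omega)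
  map_smul' r B := by
    refine vertexOperator_ext fun k w => ?_
    rw [RingHom.id_apply, map_smul, Pi.smul_apply, LinearMap.smul_apply]
    simp only [fieldProduct_ncoeff]
    obtain ⟨N, a, b, -⟩ := exists_bound₁ A B w
    rw [fieldProductCoeff_eq_sum (N + k.natAbs) (B := B),
      fieldProductCoeff_eq_sum (N + k.natAbs) (B := r • B)]
    · simp only [map_smul, Pi.smul_apply, LinearMap.smul_apply, smul_sub, Finset.smul_sum,
        smul_comm r]
    · intro j hj
      rw [map_smul, Pi.smul_apply, LinearMap.smul_apply, b _ (by omega), smul_zero]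
    · intro j hj; exact a _ (by omega)
    · intro j hj; exact b _ (by omega)
    · intro j hj; exact a _ (by omega)

theorem fieldProductHom_ncoeff (A B : VertexOperator ℂ V) (m k : ℤ) (w : V) :
    ((fieldProductHom A m B)[[k]]) w = fieldProductCoeff A B m k w :=
  fieldProduct_ncoeff A B m k w

open Finset in
theorem sum_range_sum_range {W : Type*} [AddCommGroup W] (f : ℕ → ℕ → W) (R : ℕ)
    (h1 : ∀ i j, R ≤ i → f i j = 0) (h2 : ∀ i j, R ≤ j → f i j = 0) :
    ∑ i ∈ range R, ∑ j ∈ range R, f i j =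
      ∑ s ∈ range (2 * R), ∑ x ∈ antidiagonal s, f x.1 x.2 := by
  rw [← sum_product', sum_sigma']
  refine sum_bij_ne_zero (fun x _ _ => ⟨x.1 + x.2, x⟩) ?_ ?_ ?_ ?_
  · intro x hx _
    simp only [mem_product, mem_range] at hx
    simp only [mem_sigma, mem_range, HasAntidiagonal.mem_antidiagonal, and_true]
    omega
  · intro x _ _ y _ _ hxy
    simp only [Sigma.mk.injEq] at hxy
    exact eq_of_heq hxy.2
  · rintro ⟨s, x⟩ hx hne
    simp only [mem_sigma, mem_range, HasAntidiagonal.mem_antidiagonal] at hx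
    simp only at hne
    have hx2 := hx.2
    refine ⟨x, ?_, hne, ?_⟩
    · simp only [mem_product, mem_range]
      constructor
      · by_contra hc; exact hne (h1 _ _ (not_lt.1 hc))
      · by_contra hc; exact hne (h2 _ _ (not_lt.1 hc))
    · rw [Sigma.mk.injEq]; exact ⟨hx.2, HEq.rfl⟩
  · intro x _ _; rfl

/-- The relations `[A₍ₚ₎, A₍q₎] = (p - q) A₍ₚ₊q₋₁₎ + δ_{p+q,2} c/12 p(p-1)(p-2)` for the modes
`A₍ₚ₎ = Lₚ₋₁` of the field `A(z) = ∑ Lₙ z⁻ⁿ⁻²`. -/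
def IsVirasoroField (c : ℂ) (A : VertexOperator ℂ V) : Prop :=
  ∀ (p q : ℤ) (w : V), (A[[p]]) ((A[[q]]) w) - (A[[q]]) ((A[[p]]) w) =
    ((p : ℂ) - q) • (A[[p + q - 1]]) w +
      (if p + q = 2 then (p : ℂ) * (p - 1) * (p - 2) / 12 * c else 0) • w

theorem fieldProduct_fieldProduct_eq {A B : VertexOperator ℂ V} (p q k : ℤ) (w : V) :
    ∃ R₀ : ℕ, ∀ R, R₀ ≤ R → fieldProductCoeff A (fieldProductHom A q B) p k w =
      (∑ i ∈ Finset.range R, ∑ j ∈ Finset.range R, (signedChoose p i * signedChoose q j) •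
        (A[[p - i]]) ((A[[q - j]]) ((B[[k + i + j]]) w))) -
      (-1 : ℂ) ^ q • (∑ i ∈ Finset.range R, ∑ j ∈ Finset.range R,
        (signedChoose p i * signedChoose q j) •
          (A[[p - i]]) ((B[[q + k + i - j]]) ((A[[(j : ℤ)]]) w))) -
      (-1 : ℂ) ^ p • (∑ i ∈ Finset.range R, ∑ j ∈ Finset.range R,
        (signedChoose q i * signedChoose p j) •
          (A[[q - i]]) ((B[[p + k + i - j]]) ((A[[(j : ℤ)]]) w))) +
      (-1 : ℂ) ^ (p + q) • (∑ i ∈ Finset.range R, ∑ j ∈ Finset.range R,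
        (signedChoose p i * signedChoose q j) •
          (B[[p + q + k - i - j]]) ((A[[(j : ℤ)]]) ((A[[(i : ℤ)]]) w))) := by
  obtain ⟨N₁, a₁, b₁, c₁⟩ := exists_bound₁ A B w
  obtain ⟨N₂, a₂, -, c₂⟩ := exists_bound₁ A A w
  refine ⟨2 * (N₁ + N₂) + p.natAbs + q.natAbs + k.natAbs, fun R hR => ?_⟩
  have hz : ∀ i j : ℕ, R ≤ i → (B[[q + k + i - j]]) ((A[[(j : ℤ)]]) w) = 0 := by
    intro i j hi
    by_cases hj : j < N₁
    · exact c₁ j _ (by omega)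
    · rw [a₁ _ (by omega), map_zero]
  have hin : ∀ i : ℕ, fieldProductCoeff A B q (k + i) w =
      (∑ j ∈ Finset.range R, signedChoose q j • (A[[q - j]]) ((B[[k + i + j]]) w)) -
      (-1 : ℂ) ^ q • ∑ j ∈ Finset.range R,
        signedChoose q j • (B[[q + k + i - j]]) ((A[[(j : ℤ)]]) w) := by
    intro i
    rw [fieldProductCoeff_eq_sum R, ← add_assoc]
    · intro j hj; exact b₁ _ (by omega)
    · intro j hj; exact a₁ _ (by omega)
  have hin2 : ∀ i : ℕ, fieldProductCoeff A B q (p + k - i) ((A[[(i : ℤ)]]) w) =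
      (∑ j ∈ Finset.range R,
        signedChoose q j • (A[[q - j]]) ((B[[p + k + j - i]]) ((A[[(i : ℤ)]]) w))) -
      (-1 : ℂ) ^ q • ∑ j ∈ Finset.range R,
        signedChoose q j • (B[[p + q + k - i - j]]) ((A[[(j : ℤ)]]) ((A[[(i : ℤ)]]) w)) := by
    intro i
    rw [fieldProductCoeff_eq_sum R]
    · congr 1
      · refine Finset.sum_congr rfl fun j _ => ?_
        rw [show p + k - i + j = p + k + j - (i : ℤ) by ring]
      · congr 1
        refine Finset.sum_congr rfl fun j _ => ?_
        rw [show q + (p + k - i) - j = p + q + k - i - (j : ℤ) by ring]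
    · intro j hj
      by_cases hi : i < N₁
      · exact c₁ i _ (by omega)
      · rw [a₁ _ (by omega), map_zero]
    · intro j hj; exact c₂ i _ (by omega)
  rw [fieldProductCoeff_eq_sum R]
  · simp only [fieldProductHom_ncoeff, hin, hin2, map_sub, map_sum, map_smul, smul_sub,
      Finset.smul_sum, Finset.sum_sub_distrib, smul_smul]
    rw [zpow_add₀ (by norm_num)]
    have e : ∀ f : ℕ → ℕ → V, ∑ i ∈ Finset.range R, ∑ j ∈ Finset.range R, f i j =
      ∑ j ∈ Finset.range R, ∑ i ∈ Finset.range R, f i j := fun f => Finset.sum_comm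
    rw [e fun i j => ((-1 : ℂ) ^ p * (signedChoose p i * signedChoose q j)) •
      (A[[q - j]]) ((B[[p + k + j - i]]) ((A[[(i : ℤ)]]) w))]
    rw [← sub_add]
    congr 1
    · congr 1
      · congr 1
        refine Finset.sum_congr rfl fun i _ => Finset.sum_congr rfl fun j _ => ?_
        congr 1; ring
      · refine Finset.sum_congr rfl fun i _ => Finset.sum_congr rfl fun j _ => ?_
        congr 1; ring
    · refine Finset.sum_congr rfl fun i _ => Finset.sum_congr rfl fun j _ => ?_
      congr 1; ring
  · intro i hi
    rw [fieldProductHom_ncoeff, hin, Finset.sum_eq_zero, Finset.sum_eq_zero]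
    · simp
    · intro j _; rw [hz i j hi, smul_zero]
    · intro j _; rw [b₁ _ (by omega), map_zero, smul_zero]
  · intro i hi; exact a₁ _ (by omega)

open Finset in
theorem fieldProductHom_commutator {c : ℂ} {A : VertexOperator ℂ V} (hA : IsVirasoroField c A)
    (p q : ℤ) (B : VertexOperator ℂ V) :
    fieldProductHom A p (fieldProductHom A q B) - fieldProductHom A q (fieldProductHom A p B) =
      ((p : ℂ) - q) • fieldProductHom A (p + q - 1) B +
        (if p + q = 2 then (p : ℂ) * (p - 1) * (p - 2) / 12 * c else 0) • B := by
  refine vertexOperator_ext fun k w => ?_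
  simp only [map_sub, map_add, map_smul, Pi.sub_apply, Pi.add_apply, Pi.smul_apply,
    LinearMap.sub_apply, LinearMap.add_apply, LinearMap.smul_apply, fieldProductHom_ncoeff]
  obtain ⟨R₁, h₁⟩ := fieldProduct_fieldProduct_eq (A := A) (B := B) p q k w
  obtain ⟨R₂, h₂⟩ := fieldProduct_fieldProduct_eq (A := A) (B := B) q p k w
  obtain ⟨N₁, a₁, b₁, c₁⟩ := exists_bound₁ A B w
  obtain ⟨N₂, a₂, -, c₂⟩ := exists_bound₁ A A w
  obtain ⟨R, hR₁, hR₂, hR⟩ : ∃ R, R₁ ≤ R ∧ R₂ ≤ R ∧ N₁ + N₂ + k.natAbs + 1 ≤ R :=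
    ⟨R₁ + R₂ + (N₁ + N₂ + k.natAbs + 1), by omega, by omega, by omega⟩
  have e : ∀ f : ℕ → ℕ → V, ∑ i ∈ Finset.range R, ∑ j ∈ Finset.range R, f i j =
      ∑ j ∈ Finset.range R, ∑ i ∈ Finset.range R, f i j := fun f => Finset.sum_comm
  rw [h₁ R hR₁, h₂ R hR₂]
  -- the terms with `A` on the left
  have hleft : (∑ i ∈ range R, ∑ j ∈ range R, (signedChoose p i * signedChoose q j) •
        (A[[p - i]]) ((A[[q - j]]) ((B[[k + i + j]]) w))) -
      (∑ i ∈ range R, ∑ j ∈ range R, (signedChoose q i * signedChoose p j) •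
        (A[[q - i]]) ((A[[p - j]]) ((B[[k + i + j]]) w))) =
      ((p : ℂ) - q) • (∑ s ∈ range (2 * R), signedChoose (p + q - 1) s •
        (A[[p + q - 1 - s]]) ((B[[k + s]]) w)) +
        (if p + q = 2 then (p : ℂ) * (p - 1) * (p - 2) / 12 * c else 0) • (B[[k]]) w := by
    rw [e fun i j => (signedChoose q i * signedChoose p j) •
        (A[[q - i]]) ((A[[p - j]]) ((B[[k + i + j]]) w)), ← sum_sub_distrib]
    simp only [← sum_sub_distrib]
    rw [sum_range_sum_range]
    · have key : ∀ s ∈ range (2 * R), ∑ x ∈ antidiagonal s,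
          ((signedChoose p x.1 * signedChoose q x.2) •
            (A[[p - x.1]]) ((A[[q - x.2]]) ((B[[k + x.1 + x.2]]) w)) -
          (signedChoose q x.2 * signedChoose p x.1) •
            (A[[q - x.2]]) ((A[[p - x.1]]) ((B[[k + x.2 + x.1]]) w))) =
          ((p : ℂ) - q) • signedChoose (p + q - 1) s • (A[[p + q - 1 - s]]) ((B[[k + s]]) w) +
            (if p + q - s = 2 then (p : ℂ) * (p - 1) * (p - 2) * signedChoose (p + q - 3) s / 12 * c
              else 0) • (B[[k + s]]) w := by
        intro s _
        have hx : ∀ x ∈ antidiagonal s,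
            ((signedChoose p x.1 * signedChoose q x.2) •
              (A[[p - x.1]]) ((A[[q - x.2]]) ((B[[k + x.1 + x.2]]) w)) -
            (signedChoose q x.2 * signedChoose p x.1) •
              (A[[q - x.2]]) ((A[[p - x.1]]) ((B[[k + x.2 + x.1]]) w))) =
            (signedChoose p x.1 * signedChoose q x.2 * (((p : ℂ) - x.1) - ((q : ℂ) - x.2))) •
              (A[[p + q - 1 - s]]) ((B[[k + s]]) w) +
            (signedChoose p x.1 * signedChoose q x.2 *
              (((p : ℂ) - x.1) * ((p : ℂ) - x.1 - 1) * ((p : ℂ) - x.1 - 2))) •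
              (if p + q - s = 2 then c / 12 else 0) • (B[[k + s]]) w := by
          intro x hx
          have hs : (x.1 : ℤ) + x.2 = s := by exact_mod_cast HasAntidiagonal.mem_antidiagonal.1 hx
          rw [show k + x.1 + x.2 = k + s by omega, show k + x.2 + x.1 = k + s by omega,
            mul_comm (signedChoose q x.2), ← smul_sub, hA,
            show p - x.1 + (q - x.2) - 1 = p + q - 1 - s by omega,
            show p - x.1 + (q - x.2) = p + q - s by omega, smul_add, smul_smul, smul_smul,
            smul_smul]
          push_cast
          congr 2
          split_ifs <;> ring
        rw [sum_congr rfl hx, sum_add_distrib, ← sum_smul, ← sum_smul, sum_signedChoose_sub,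
          sum_signedChoose_cubic, smul_smul, smul_smul]
        congr 2
        split_ifs <;> ring
      rw [sum_congr rfl key, sum_add_distrib, ← smul_sum]
      congr 1
      rw [sum_eq_single 0]
      · simp [signedChoose_zero_right]
      · intro s _ hs
        split_ifs with h2
        · rcases s with _ | s
          · exact absurd rfl hs
          · rw [show p + q - 3 = (s : ℤ) by push_cast at h2; omega]
            simp [signedChoose, Ring.choose_natCast]
        · simp
      · intro h; exact absurd (mem_range.2 (by omega)) h
    · intro i j hi
      rw [b₁ _ (by omega), b₁ _ (by omega)]; simp
    · intro i j hi
      rw [b₁ _ (by omega), b₁ _ (by omega)]; simp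
  have hright : (∑ i ∈ range R, ∑ j ∈ range R, (signedChoose p i * signedChoose q j) •
          (B[[p + q + k - i - j]]) ((A[[(j : ℤ)]]) ((A[[(i : ℤ)]]) w))) -
      (∑ i ∈ range R, ∑ j ∈ range R, (signedChoose q i * signedChoose p j) •
          (B[[p + q + k - i - j]]) ((A[[(j : ℤ)]]) ((A[[(i : ℤ)]]) w))) =
      ((p : ℂ) - q) • (∑ s ∈ range (2 * R), signedChoose (p + q - 1) s •
        (B[[p + q - 1 + k - s]]) ((A[[(s : ℤ)]]) w)) := by
    rw [e fun i j => (signedChoose q i * signedChoose p j) •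
        (B[[p + q + k - i - j]]) ((A[[(j : ℤ)]]) ((A[[(i : ℤ)]]) w)), ← sum_sub_distrib]
    simp only [← sum_sub_distrib]
    rw [sum_range_sum_range]
    · have key : ∀ s, ∑ x ∈ antidiagonal s,
          ((signedChoose p x.1 * signedChoose q x.2) •
            (B[[p + q + k - x.1 - x.2]]) ((A[[(x.2 : ℤ)]]) ((A[[(x.1 : ℤ)]]) w)) -
          (signedChoose q x.2 * signedChoose p x.1) •
            (B[[p + q + k - x.2 - x.1]]) ((A[[(x.1 : ℤ)]]) ((A[[(x.2 : ℤ)]]) w))) =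
          (∑ x ∈ antidiagonal s, signedChoose p x.1 * signedChoose q x.2 * ((x.2 : ℂ) - x.1)) •
            (B[[p + q + k - s]]) ((A[[(s : ℤ) - 1]]) w) := by
        intro s
        rw [sum_smul]
        refine sum_congr rfl fun x hx => ?_
        have hs : (x.1 : ℤ) + x.2 = s := by exact_mod_cast HasAntidiagonal.mem_antidiagonal.1 hx
        rw [show p + q + k - x.1 - x.2 = p + q + k - s by omega,
          show p + q + k - x.2 - x.1 = p + q + k - s by omega,
          mul_comm (signedChoose q x.2), ← smul_sub, ← map_sub, hA,
          show (x.2 : ℤ) + x.1 - 1 = s - 1 by omega]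
        have hz : (if (x.2 : ℤ) + x.1 = 2 then
            (((x.2 : ℤ) : ℂ)) * (((x.2 : ℤ) : ℂ) - 1) * (((x.2 : ℤ) : ℂ) - 2) / 12 * c
              else 0) = 0 := by
          split_ifs with h2
          · have : x.2 = 0 ∨ x.2 = 1 ∨ x.2 = 2 := by omega
            rcases this with h | h | h <;> simp [h]
          · rfl
        rw [hz, zero_smul, add_zero, map_smul, smul_smul]
        push_cast
        rfl
      simp only [key]
      obtain ⟨M, hM⟩ : ∃ M, 2 * R = M + 1 := ⟨2 * R - 1, by omega⟩
      rw [hM, sum_range_succ', sum_range_succ]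
      have h0 : (A[[(M : ℤ)]]) w = 0 := a₁ _ (by omega)
      rw [h0]
      simp only [sum_signedChoose_diff, map_zero, smul_zero, add_zero]
      rw [smul_sum]
      simp only [Finset.Nat.antidiagonal_zero, sum_singleton, Nat.cast_zero, sub_zero, mul_zero, zero_smul,
        add_zero]
      refine sum_congr rfl fun s _ => ?_
      rw [smul_smul]
      push_cast
      rw [show p + q + k - ((s : ℤ) + 1) = p + q - 1 + k - s by ring,
        show (s : ℤ) + 1 - 1 = s by ring]
    · intro i j hi
      rw [a₁ i (by omega), c₂ j i (by omega)]; simp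
    · intro i j hi
      rw [a₁ j (by omega), c₂ i j (by omega)]; simp
  rw [fieldProductCoeff_eq_sum (2 * R)]
  · have hsgn : (-1 : ℂ) ^ (p + q - 1) = - (-1 : ℂ) ^ (p + q) := by
      rw [zpow_sub_one₀ (by norm_num)]; norm_num
    rw [hsgn, add_comm q p]
    generalize (-1 : ℂ) ^ (p + q) = ε
    linear_combination (norm := module) hleft + ε • hright
  · intro j hj; exact b₁ _ (by omega)
  · intro j hj; exact a₁ _ (by omega)

end Fields

/-- The underlying vector space `(⨁ₙ ℂ Lₙ) ⊕ ℂ C` of the Virasoro algebra. -/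
def Vir : Type := (ℤ →₀ ℂ) × ℂ

namespace Vir

instance : AddCommGroup Vir := inferInstanceAs (AddCommGroup ((ℤ →₀ ℂ) × ℂ))
instance : Module ℂ Vir := inferInstanceAs (Module ℂ ((ℤ →₀ ℂ) × ℂ))

/-- The basis vector `Lₙ`. -/
def L (n : ℤ) : Vir := (Finsupp.single n 1, 0)

/-- The central element `C`. -/
def C : Vir := (0, 1)

/-- The linear projection of the Virasoro algebra along `C`. -/
def proj : Vir →ₗ[ℂ] (ℤ →₀ ℂ) := LinearMap.fst ℂ (ℤ →₀ ℂ) ℂ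

/-- `[Lₙ, Lₘ] = (n - m) Lₙ₊ₘ + δ_{n,-m} (n³ - n)/12 C`. -/
def basisBracket (n m : ℤ) : Vir :=
  ((n : ℂ) - m) • L (n + m) + (if n = -m then ((n : ℂ) ^ 3 - n) / 12 else 0) • C

/-- The bilinear extension of `basisBracket`. -/
def bracketHom : (ℤ →₀ ℂ) →ₗ[ℂ] (ℤ →₀ ℂ) →ₗ[ℂ] Vir :=
  Finsupp.linearCombination ℂ fun n => Finsupp.linearCombination ℂ fun m => basisBracket n m

theorem bracketHom_single (n m : ℤ) (r s : ℂ) :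
    bracketHom (Finsupp.single n r) (Finsupp.single m s) = (r * s) • basisBracket n m := by
  simp [bracketHom, Finsupp.linearCombination_single, smul_smul]

theorem basisBracket_skew (n m : ℤ) : basisBracket n m = - basisBracket m n := by
  unfold basisBracket
  rw [add_comm m n, neg_add, ← neg_smul, ← neg_smul]
  congr 2
  · ring
  · by_cases h : n = -m
    · subst h; simp; ring
    · have : ¬ m = -n := by omega
      simp [h, this]

theorem bracketHom_skew (x y : ℤ →₀ ℂ) : bracketHom x y = - bracketHom y x := by
  induction x using Finsupp.induction_linear with
  | zero => simp
  | add f g hf hg => simp [hf, hg]; abel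
  | single n r =>
    induction y using Finsupp.induction_linear with
    | zero => simp
    | add f g hf hg => simp [hf, hg]; abel
    | single m s =>
      rw [bracketHom_single, bracketHom_single, basisBracket_skew, smul_neg, mul_comm]

theorem proj_basisBracket (n m : ℤ) :
    proj (basisBracket n m) = Finsupp.single (n + m) ((n : ℂ) - m) := by
  have hL : proj (L (n + m)) = Finsupp.single (n + m) 1 := rfl
  have hC : proj C = 0 := rfl
  rw [basisBracket, map_add, map_smul, map_smul, hL, hC, smul_zero, add_zero, Finsupp.smul_single,
    smul_eq_mul, mul_one]

theorem basisBracket_jacobi (n m k : ℤ) :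
    ((m : ℂ) - k) • basisBracket n (m + k) =
      ((n : ℂ) - m) • basisBracket (n + m) k + ((n : ℂ) - k) • basisBracket m (n + k) := by
  unfold basisBracket
  rw [show n + (m + k) = n + m + k by ring, show m + (n + k) = n + m + k by ring]
  simp only [smul_add, smul_smul]
  rw [add_add_add_comm, ← add_smul, ← add_smul]
  congr 2
  · push_cast; ring
  · by_cases h : n = -(m + k)
    · have h1 : n + m = -k := by omega
      have h2 : m = -(n + k) := by omega
      rw [if_pos h, if_pos h1, if_pos h2, h]
      push_cast; ring
    · have h1 : ¬ n + m = -k := by omega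
      have h2 : ¬ m = -(n + k) := by omega
      rw [if_neg h, if_neg h1, if_neg h2]; simp

theorem bracketHom_jacobi (x y z : ℤ →₀ ℂ) :
    bracketHom x (proj (bracketHom y z)) =
      bracketHom (proj (bracketHom x y)) z + bracketHom y (proj (bracketHom x z)) := by
  induction x using Finsupp.induction_linear with
  | zero => simp
  | add f g hf hg => simp only [map_add, LinearMap.add_apply, hf, hg]; abel
  | single n r =>
    induction y using Finsupp.induction_linear with
    | zero => simp
    | add f g hf hg => simp only [map_add, LinearMap.add_apply, hf, hg]; abel
    | single m s =>
      induction z using Finsupp.induction_linear with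
      | zero => simp
      | add f g hf hg => simp only [map_add, hf, hg]; abel
      | single k t =>
        simp only [bracketHom_single, map_smul, LinearMap.smul_apply, proj_basisBracket]
        have h := congrArg (fun v => (r * s * t) • v) (basisBracket_jacobi n m k)
        simp only [smul_add, smul_smul] at h ⊢
        convert h using 2 <;> ring_nf

instance : Bracket Vir Vir := ⟨fun x y => bracketHom (proj x) (proj y)⟩

theorem lie_def (x y : Vir) : ⁅x, y⁆ = bracketHom (proj x) (proj y) := rfl

instance : LieRing Vir where
  add_lie x y z := by simp [lie_def]
  lie_add x y z := by simp [lie_def]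
  lie_self x := by
    have h := bracketHom_skew (proj x) (proj x)
    rw [lie_def]
    have h2 : (2 : ℂ) • bracketHom (proj x) (proj x) = 0 := by
      rw [two_smul]; nth_rewrite 1 [h]; simp
    simpa using h2
  leibniz_lie x y z := bracketHom_jacobi _ _ _

instance : LieAlgebra ℂ Vir where
  lie_smul t x y := by simp [lie_def]

theorem lie_L_L (n m : ℤ) : ⁅L n, L m⁆ = basisBracket n m := by
  have : ∀ k, proj (L k) = Finsupp.single k 1 := fun k => rfl
  rw [lie_def, this, this, bracketHom_single, one_mul, one_smul]

theorem lie_C (x : Vir) : ⁅x, C⁆ = 0 := by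
  have : proj C = 0 := rfl
  rw [lie_def, this, map_zero]

/-- The inclusion of the span of the `Lₙ`. -/
def incl : (ℤ →₀ ℂ) →ₗ[ℂ] Vir := LinearMap.inl ℂ (ℤ →₀ ℂ) ℂ

/-- The coefficient of `C`. -/
def central : Vir →ₗ[ℂ] ℂ := LinearMap.snd ℂ (ℤ →₀ ℂ) ℂ

theorem incl_single (n : ℤ) (r : ℂ) : incl (Finsupp.single n r) = r • L n := by
  refine Prod.ext ?_ ?_
  · change Finsupp.single n r = r • Finsupp.single n (1 : ℂ)
    simp
  · change (0 : ℂ) = r • (0 : ℂ)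
    simp

theorem incl_add_central (x : Vir) : incl (proj x) + central x • C = x := by
  refine Prod.ext ?_ ?_
  · change x.1 + x.2 • (0 : ℤ →₀ ℂ) = x.1
    simp
  · change 0 + x.2 • (1 : ℂ) = x.2
    simp

theorem proj_L (n : ℤ) : proj (L n) = Finsupp.single n 1 := rfl
theorem proj_C : proj C = 0 := rfl
theorem central_L (n : ℤ) : central (L n) = 0 := rfl
theorem central_C : central C = 1 := rfl

end Vir

/-- The universal enveloping algebra of the Virasoro algebra. -/
abbrev UVir : Type := UniversalEnvelopingAlgebra ℂ Vir

section

attribute [local instance] LieRing.ofAssociativeRing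

/-- The inclusion of the Virasoro algebra in its universal enveloping algebra. -/
def Vir.toU : Vir →ₗ[ℂ] UVir := (UniversalEnvelopingAlgebra.ι ℂ : Vir →ₗ⁅ℂ⁆ UVir).toLinearMap

end

/-- The left ideal of `U(vir)` generated by `Lₙ`, `n ≥ -1`, and `C - c`. -/
def virIdeal (c : ℂ) : Submodule UVir UVir :=
  Submodule.span UVir ({u | ∃ n : ℤ, -1 ≤ n ∧ u = Vir.toU (Vir.L n)} ∪
    {Vir.toU Vir.C - algebraMap ℂ UVir c})

/-- The induced module `Virᶜ = U(vir) ⊗ ℂ_c`, where `C` acts on `ℂ_c` by `c` and `Lₙ` by zero for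
`n ≥ -1`, i.e. the quotient of `U(vir)` by the left ideal generated by `Lₙ` (`n ≥ -1`), `C - c`. -/
abbrev VirC (c : ℂ) : Type := UVir ⧸ virIdeal c

namespace VirC

variable (c : ℂ)

/-- The vacuum vector `1 ⊗ 1`. -/
def vac : VirC c := (virIdeal c).mkQ 1

/-- The action of `Lₙ` on `Virᶜ`. -/
def opL (n : ℤ) : Module.End ℂ (VirC c) := Algebra.lsmul ℂ ℂ (VirC c) (Vir.toU (Vir.L n))

/-- The conformal vector `L = L₋₂|0⟩`. -/
def conf : VirC c := opL c (-2) (vac c)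

variable {c}

theorem opL_apply (n : ℤ) (w : VirC c) : opL c n w = Vir.toU (Vir.L n) • w := rfl

section

attribute [local instance] LieRing.ofAssociativeRing

theorem adjoin_toU : Algebra.adjoin ℂ (Set.range Vir.toU) = ⊤ := by
  let S := Algebra.adjoin ℂ (Set.range Vir.toU)
  let f : Vir →ₗ⁅ℂ⁆ S :=
    { toFun := fun x => ⟨Vir.toU x, Algebra.subset_adjoin ⟨x, rfl⟩⟩
      map_add' := fun x y => Subtype.ext (map_add Vir.toU x y)
      map_smul' := fun r x => Subtype.ext (map_smul Vir.toU r x)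
      map_lie' := fun {x y} => Subtype.ext (LieHom.map_lie (UniversalEnvelopingAlgebra.ι ℂ) x y) }
  have h : S.val.comp (UniversalEnvelopingAlgebra.lift ℂ f) = AlgHom.id ℂ UVir := by
    refine UniversalEnvelopingAlgebra.hom_ext (R := ℂ) (LieHom.ext fun x => ?_)
    have := UniversalEnvelopingAlgebra.lift_ι_apply ℂ f x
    exact congrArg Subtype.val this
  refine eq_top_iff.2 fun u _ => ?_
  have hu := congrArg (fun g => g u) h
  simp only [AlgHom.comp_apply, AlgHom.id_apply] at hu
  rw [← hu]
  exact (UniversalEnvelopingAlgebra.lift ℂ f u).2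

theorem toU_comm (x y : Vir) : Vir.toU x * Vir.toU y - Vir.toU y * Vir.toU x = Vir.toU ⁅x, y⁆ :=
  (LieHom.map_lie (UniversalEnvelopingAlgebra.ι ℂ) x y).symm

end

theorem toU_C_comm (u : UVir) : u * Vir.toU Vir.C = Vir.toU Vir.C * u := by
  have hu : u ∈ Algebra.adjoin ℂ (Set.range Vir.toU) := by rw [adjoin_toU]; trivial
  induction hu using Algebra.adjoin_induction with
  | mem x hx =>
    obtain ⟨x, rfl⟩ := hx
    rw [← sub_eq_zero, toU_comm, Vir.lie_C]
    exact map_zero Vir.toU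
  | algebraMap r => exact Algebra.commutes r _
  | add x y _ _ hx hy => rw [add_mul, mul_add, hx, hy]
  | mul x y _ _ hx hy => rw [mul_assoc, hy, ← mul_assoc, hx, mul_assoc]

theorem exists_smul_vac (w : VirC c) : ∃ u : UVir, w = u • vac c := by
  obtain ⟨u, rfl⟩ := (virIdeal c).mkQ_surjective w
  exact ⟨u, by rw [vac, ← map_smul, smul_eq_mul, mul_one]⟩

theorem toU_L_smul_vac (n : ℤ) (hn : -1 ≤ n) : Vir.toU (Vir.L n) • vac c = 0 := by
  rw [vac, ← map_smul, smul_eq_mul, mul_one, Submodule.mkQ_apply, Submodule.Quotient.mk_eq_zero]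
  exact Submodule.subset_span (Or.inl ⟨n, hn, rfl⟩)

theorem toU_C_smul (w : VirC c) : Vir.toU Vir.C • w = c • w := by
  obtain ⟨u, rfl⟩ := exists_smul_vac w
  have h : (Vir.toU Vir.C - algebraMap ℂ UVir c) • vac c = 0 := by
    rw [vac, ← map_smul, smul_eq_mul, mul_one, Submodule.mkQ_apply, Submodule.Quotient.mk_eq_zero]
    exact Submodule.subset_span (Or.inr rfl)
  rw [sub_smul, algebraMap_smul, sub_eq_zero] at h
  rw [smul_smul, ← toU_C_comm, mul_smul, h, smul_comm]

theorem opL_comm (n m : ℤ) (w : VirC c) :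
    opL c n (opL c m w) - opL c m (opL c n w) = ((n : ℂ) - m) • opL c (n + m) w +
      (if n = -m then ((n : ℂ) ^ 3 - n) / 12 * c else 0) • w := by
  simp only [opL_apply]
  rw [smul_smul, smul_smul, ← sub_smul, toU_comm, Vir.lie_L_L, Vir.basisBracket]
  rw [map_add, map_smul, map_smul, add_smul, smul_assoc, smul_assoc, toU_C_smul, smul_smul]
  congr 2
  split_ifs <;> simp

theorem opL_eventually_zero (w : VirC c) : ∃ N : ℕ, ∀ n : ℤ, N ≤ n → opL c n w = 0 := by
  have main : ∀ u : UVir, ∀ w : VirC c, (∃ N : ℕ, ∀ n : ℤ, N ≤ n → opL c n w = 0) →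
      ∃ N : ℕ, ∀ n : ℤ, N ≤ n → opL c n (u • w) = 0 := by
    intro u
    have hu : u ∈ Algebra.adjoin ℂ (Set.range Vir.toU) := by rw [adjoin_toU]; trivial
    induction hu using Algebra.adjoin_induction with
    | mem x hx =>
      obtain ⟨x, rfl⟩ := hx
      rintro w ⟨N, hN⟩
      have hx : ∀ w : VirC c, Vir.toU x • w =
          (∑ m ∈ (Vir.proj x).support, Vir.proj x m • opL c m w) + (Vir.central x * c) • w := by
        intro w
        have e : x = (∑ m ∈ (Vir.proj x).support, Vir.proj x m • Vir.L m) +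
            Vir.central x • Vir.C := by
          conv_lhs => rw [← Vir.incl_add_central x]
          congr 1
          conv_lhs => rw [← Finsupp.sum_single (Vir.proj x), Finsupp.sum, map_sum]
          exact Finset.sum_congr rfl fun m _ => Vir.incl_single m _
        conv_lhs => rw [e]
        rw [map_add, map_sum, map_smul, add_smul, Finset.sum_smul, smul_assoc, toU_C_smul,
          smul_smul]
        congr 1
        refine Finset.sum_congr rfl fun m _ => ?_
        rw [map_smul, smul_assoc, opL_apply]
      refine ⟨N + ∑ m ∈ (Vir.proj x).support, m.natAbs + 1, fun n hn => ?_⟩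
      rw [hx, map_add, map_smul, hN n (by omega), smul_zero, add_zero, map_sum]
      refine Finset.sum_eq_zero fun m hm => ?_
      have hle := Finset.single_le_sum (f := fun m : ℤ => m.natAbs) (fun i _ => Nat.zero_le _) hm
      rw [map_smul]
      have h := opL_comm n m w
      rw [hN n (by omega), hN (n + m) (by omega), if_neg (by omega)] at h
      simp only [map_zero, sub_zero, smul_zero, zero_smul, add_zero] at h
      rw [h, smul_zero]
    | algebraMap r =>
      rintro w ⟨N, hN⟩
      exact ⟨N, fun n hn => by rw [algebraMap_smul, map_smul, hN n hn, smul_zero]⟩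
    | add x y _ _ hx hy =>
      intro w hw
      obtain ⟨N₁, h₁⟩ := hx w hw
      obtain ⟨N₂, h₂⟩ := hy w hw
      exact ⟨N₁ + N₂, fun n hn => by
        rw [add_smul, map_add, h₁ n (by omega), h₂ n (by omega), add_zero]⟩
    | mul x y _ _ hx hy =>
      intro w hw
      rw [mul_smul]
      exact hx _ (hy w hw)
  obtain ⟨u, rfl⟩ := exists_smul_vac w
  exact main u _ ⟨0, fun n hn => toU_L_smul_vac n (by omega)⟩

variable (c) in
/-- The field `L(z) = ∑ Lₙ z⁻ⁿ⁻²` on `Virᶜ`. -/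
def fieldL : VertexOperator ℂ (VirC c) :=
  VertexOperator.of_coeff (fun n => opL c (-n - 2)) fun w => by
    obtain ⟨N, hN⟩ := opL_eventually_zero w
    refine ⟨-N - 2, fun n hn => ?_⟩
    by_contra hc
    exact hn (hN _ (by omega))

variable (c) in
/-- The identity field. -/
def fieldId : VertexOperator ℂ (VirC c) :=
  VertexOperator.of_coeff (fun n => (if n = 0 then LinearMap.id else 0 : Module.End ℂ (VirC c)))
    fun w => by
      refine ⟨0, fun n hn => ?_⟩
      by_contra hc
      have h0 : ¬ n = 0 := by omega
      exact hn (by simp [h0])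

open scoped VertexOperator

theorem fieldL_ncoeff (n : ℤ) : (fieldL c)[[n]] = opL c (n - 1) := by
  rw [fieldL, VertexOperator.ncoeff_of_coeff]
  congr 1; ring

theorem fieldId_ncoeff (n : ℤ) :
    (fieldId c)[[n]] = if n = -1 then LinearMap.id else 0 := by
  refine (VertexOperator.ncoeff_of_coeff _ _ n).trans ?_
  simp only [show (-n - 1 = 0) ↔ (n = -1) by omega]

theorem isVirasoroField_fieldL : IsVirasoroField c (fieldL c) := by
  intro p q w
  simp only [fieldL_ncoeff]
  rw [opL_comm, show p - 1 + (q - 1) = p + q - 1 - 1 by ring]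
  simp only [show (p - 1 = -(q - 1)) ↔ (p + q = 2) by omega]
  congr 2
  · push_cast; ring
  · split_ifs
    · push_cast; ring
    · rfl

variable (c) in
/-- The operators `Lₙ ↦ L(z)₍ₙ₊₁₎`, `C ↦ c` on the space of fields. -/
def fieldAction : Vir →ₗ[ℂ] Module.End ℂ (VertexOperator ℂ (VirC c)) :=
  (Finsupp.linearCombination ℂ fun n => fieldProductHom (fieldL c) (n + 1)).comp Vir.proj +
    (LinearMap.toSpanSingleton ℂ _ (c • (1 : Module.End ℂ (VertexOperator ℂ (VirC c))))).comp
      Vir.central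

theorem fieldAction_L (n : ℤ) :
    fieldAction c (Vir.L n) = fieldProductHom (fieldL c) (n + 1) := by
  simp [fieldAction, Vir.proj_L, Vir.central_L]

theorem fieldAction_C : fieldAction c Vir.C = c • 1 := by
  simp [fieldAction, Vir.proj_C, Vir.central_C]

theorem fieldAction_basisBracket (n m : ℤ) :
    fieldAction c (Vir.basisBracket n m) +
      fieldProductHom (fieldL c) (m + 1) * fieldProductHom (fieldL c) (n + 1) =
      fieldProductHom (fieldL c) (n + 1) * fieldProductHom (fieldL c) (m + 1) := by
  rw [Vir.basisBracket, map_add, map_smul, map_smul, fieldAction_L, fieldAction_C]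
  refine LinearMap.ext fun B => ?_
  have h := fieldProductHom_commutator (isVirasoroField_fieldL (c := c)) (n + 1) (m + 1) B
  rw [sub_eq_iff_eq_add, show n + 1 + (m + 1) - 1 = n + m + 1 by ring] at h
  simp only [show (n + 1 + (m + 1) = 2) ↔ (n = -m) by omega] at h
  simp only [Module.End.mul_apply, LinearMap.add_apply, LinearMap.smul_apply,
    Module.End.one_apply]
  rw [h, smul_smul]
  congr 3
  · push_cast; ring
  · split_ifs
    · push_cast; ring
    · ring

theorem fieldAction_bracketHom (f g : ℤ →₀ ℂ) :
    fieldAction c (Vir.bracketHom f g) + fieldAction c (Vir.incl g) * fieldAction c (Vir.incl f) =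
      fieldAction c (Vir.incl f) * fieldAction c (Vir.incl g) := by
  induction f using Finsupp.induction_linear with
  | zero => simp
  | add f f' hf hf' =>
    simp only [map_add, LinearMap.add_apply, add_mul, mul_add]
    rw [add_add_add_comm, hf, hf']
  | single n r =>
    induction g using Finsupp.induction_linear with
    | zero => simp
    | add f f' hf hf' =>
      simp only [map_add, add_mul, mul_add]
      rw [add_add_add_comm, hf, hf']
    | single m s =>
      rw [Vir.bracketHom_single, map_smul, Vir.incl_single, Vir.incl_single, map_smul, map_smul,
        fieldAction_L, fieldAction_L, smul_mul_smul_comm, smul_mul_smul_comm, mul_comm s r,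
        ← smul_add, fieldAction_basisBracket]

theorem fieldAction_lie (x y : Vir) : fieldAction c ⁅x, y⁆ + fieldAction c y * fieldAction c x =
    fieldAction c x * fieldAction c y := by
  have hx : ∀ x : Vir, fieldAction c x =
      fieldAction c (Vir.incl (Vir.proj x)) + (Vir.central x * c) • 1 := by
    intro x
    conv_lhs => rw [← Vir.incl_add_central x]
    rw [map_add, map_smul, fieldAction_C, smul_smul]
  rw [Vir.lie_def, hx x, hx y]
  simp only [add_mul, mul_add, smul_mul_assoc, mul_smul_comm, one_mul, mul_one, smul_add]
  rw [← fieldAction_bracketHom (Vir.proj x) (Vir.proj y),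
    smul_comm (Vir.central x * c) (Vir.central y * c)]
  abel

section

attribute [local instance] LieRing.ofAssociativeRing

variable (c) in
/-- The Virasoro algebra acts on the fields on `Virᶜ` by `Lₙ A(z) = L(z)₍ₙ₊₁₎A(z)`, with central
charge `c`. -/
def fieldRep : Vir →ₗ⁅ℂ⁆ Module.End ℂ (VertexOperator ℂ (VirC c)) where
  toFun x := fieldAction c x
  map_add' x y := map_add (fieldAction c) x y
  map_smul' r x := map_smul (fieldAction c) r x
  map_lie' {x y} := eq_sub_of_add_eq (fieldAction_lie x y)

variable (c) in
/-- The extension of this action to `U(vir)`. -/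
def fieldRepU : UVir →ₐ[ℂ] Module.End ℂ (VertexOperator ℂ (VirC c)) :=
  UniversalEnvelopingAlgebra.lift ℂ (fieldRep c)

theorem fieldRepU_toU (x : Vir) : fieldRepU c (Vir.toU x) = fieldAction c x :=
  UniversalEnvelopingAlgebra.lift_ι_apply ℂ (fieldRep c) x

end

theorem fieldProductHom_fieldId (n : ℤ) (hn : -1 ≤ n) :
    fieldProductHom (fieldL c) (n + 1) (fieldId c) = 0 := by
  refine vertexOperator_ext fun k w => ?_
  rw [fieldProductHom_ncoeff, map_zero, Pi.zero_apply, LinearMap.zero_apply, fieldProductCoeff]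
  obtain ⟨p, hp⟩ := Int.eq_ofNat_of_zero_le (show 0 ≤ n + 1 by omega)
  rw [hp]
  have hch : ∀ j : ℕ, signedChoose (p : ℤ) j = (-1) ^ j * (p.choose j : ℂ) := fun j => by
    simp [signedChoose, Ring.choose_natCast]
  simp only [fieldId_ncoeff]
  have e1 : ∑ᶠ j : ℕ, signedChoose (p : ℤ) j • ((fieldL c)[[(p : ℤ) - j]])
      ((if k + j = -1 then LinearMap.id else 0 : Module.End ℂ (VirC c)) w) =
      if 0 ≤ -1 - k then (signedChoose p (-1 - k).toNat) • ((fieldL c)[[(p : ℤ) + k + 1]]) w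
        else 0 := by
    rw [finsum_eq_single _ (-1 - k).toNat]
    · split_ifs with h1 h2 h2
      · rw [LinearMap.id_apply]
        rw [show (p : ℤ) - ((-1 - k).toNat : ℕ) = p + k + 1 by omega]
      · omega
      · omega
      · simp
    · intro j hj
      rw [if_neg (by omega)]; simp
  have e2 : ∑ᶠ j : ℕ, signedChoose (p : ℤ) j •
      (if (p : ℤ) + k - j = -1 then LinearMap.id else 0 : Module.End ℂ (VirC c))
        (((fieldL c)[[(j : ℤ)]]) w) =
      if 0 ≤ (p : ℤ) + k + 1 then
        (signedChoose p (p + k + 1).toNat) • ((fieldL c)[[(p : ℤ) + k + 1]]) w else 0 := by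
    rw [finsum_eq_single _ ((p : ℤ) + k + 1).toNat]
    · split_ifs with h1 h2 h2
      · rw [LinearMap.id_apply, Int.toNat_of_nonneg h2]
      · omega
      · omega
      · simp
    · intro j hj
      rw [if_neg (by omega)]; simp
  rw [e1, e2, hch, hch]
  by_cases h1 : 0 ≤ -1 - k <;> by_cases h2 : 0 ≤ (p : ℤ) + k + 1
  · rw [if_pos h1, if_pos h2, smul_smul, ← sub_smul]
    obtain ⟨a, ha⟩ := Int.eq_ofNat_of_zero_le h1
    obtain ⟨b, hb⟩ := Int.eq_ofNat_of_zero_le h2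
    have hab : a + b = p := by omega
    rw [ha, hb, ← hab]
    simp only [Int.toNat_natCast, zpow_natCast]
    rw [Nat.choose_symm_add, ← mul_assoc, ← pow_add, show a + b + b = a + 2 * b by ring, pow_add, pow_mul]
    simp
  · rw [if_pos h1, if_neg h2, Nat.choose_eq_zero_of_lt (by omega)]; simp
  · rw [if_neg h1, if_pos h2, Nat.choose_eq_zero_of_lt (by omega)]; simp
  · rw [if_neg h1, if_neg h2]; simp

variable (c) in
/-- The linear map `u ↦ u · I` from `U(vir)` to the space of fields. -/
def preY : UVir →ₗ[ℂ] VertexOperator ℂ (VirC c) :=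
  (LinearMap.applyₗ (fieldId c)).comp (fieldRepU c).toLinearMap

theorem preY_mul (u v : UVir) : preY c (u * v) = fieldRepU c u (preY c v) := by
  simp [preY]

theorem preY_eq_zero : (virIdeal c).restrictScalars ℂ ≤ LinearMap.ker (preY c) := by
  intro u hu
  rw [Submodule.restrictScalars_mem] at hu
  rw [LinearMap.mem_ker]
  induction hu using Submodule.span_induction with
  | mem u hu =>
    rcases hu with ⟨n, hn, rfl⟩ | rfl
    · have : preY c (Vir.toU (Vir.L n)) = fieldRepU c (Vir.toU (Vir.L n)) (fieldId c) := rfl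
      rw [this, fieldRepU_toU]
      rw [fieldAction_L, fieldProductHom_fieldId n hn]
    · have : preY c (Vir.toU Vir.C - algebraMap ℂ UVir c) =
        fieldRepU c (Vir.toU Vir.C - algebraMap ℂ UVir c) (fieldId c) := rfl
      rw [this, map_sub, fieldRepU_toU, AlgHom.commutes]
      rw [fieldAction_C, Algebra.algebraMap_eq_smul_one, sub_self, LinearMap.zero_apply]
  | zero => exact map_zero _
  | add x y _ _ hx hy => rw [map_add, hx, hy, add_zero]
  | smul a x _ hx => rw [smul_eq_mul, preY_mul, hx, map_zero]

variable (c) in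
/-- The state-field correspondence of `Virᶜ`:
`Y(Lₘ u, z) = L(z)₍ₘ₊₁₎Y(u, z)` and `Y(|0⟩, z) = I`, so that
`Y(L_{-n₁-2} ⋯ L_{-nᵣ-2}|0⟩, z) = :∂⁽ⁿ¹⁾L(z) ⋯ ∂⁽ⁿʳ⁾L(z):`. -/
def Y : VirC c →ₗ[ℂ] VertexOperator ℂ (VirC c) :=
  (((virIdeal c).restrictScalars ℂ).liftQ (preY c) preY_eq_zero).comp
    (Submodule.Quotient.restrictScalarsEquiv ℂ (virIdeal c)).symm.toLinearMap

theorem Y_vac : Y c (vac c) = fieldId c := by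
  have : Y c (vac c) = fieldRepU c 1 (fieldId c) := rfl
  rw [this, map_one, Module.End.one_apply]

theorem Y_opL (n : ℤ) (u : VirC c) : Y c (opL c n u) = fieldProduct (fieldL c) (Y c u) (n + 1) := by
  obtain ⟨u, rfl⟩ := (virIdeal c).mkQ_surjective u
  have h1 : Y c (opL c n ((virIdeal c).mkQ u)) = preY c (Vir.toU (Vir.L n) * u) := rfl
  have h2 : Y c ((virIdeal c).mkQ u) = preY c u := rfl
  rw [h1, h2, preY_mul, fieldRepU_toU, fieldAction_L]; rfl

theorem Y_conf : Y c (conf c) = fieldL c := by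
  rw [conf, Y_opL, Y_vac]
  refine vertexOperator_ext fun k w => ?_
  rw [fieldProduct_ncoeff, fieldProductCoeff]
  have hch : ∀ j : ℕ, signedChoose (-2 + 1) j = 1 := fun j => by
    have h := Ring.choose_neg' (1 : ℤ) j
    rw [Ring.multichoose_one] at h
    rw [signedChoose, show (-2 + 1 : ℤ) = -1 by norm_num, h, Units.smul_def, Int.negOnePow_def,
      zpow_natCast]
    push_cast
    rw [smul_eq_mul, mul_one]
    push_cast
    rw [← mul_pow]; simp
  simp only [hch, fieldId_ncoeff, one_smul]
  rw [finsum_eq_single _ (-1 - k).toNat, finsum_eq_single _ k.toNat]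
  · by_cases hk : 0 ≤ k
    · rw [if_neg (by omega), if_pos (by omega), Int.toNat_of_nonneg hk]
      norm_num
    · rw [if_pos (by omega), if_neg (by omega),
        show (-2 + 1 : ℤ) - ((-1 - k).toNat : ℕ) = k by omega]
      simp
  · intro j hj; rw [if_neg (by omega)]; rfl
  · intro j hj; rw [if_neg (by omega)]; simp

end VirC

section Modules

open scoped VertexOperator

/-- A module over the vertex algebra `Virᶜ`: a vector space `M` with `T ∈ End M` and a linear map
`v ↦ Y(v, z) = ∑ v₍ₙ₎ z⁻ⁿ⁻¹ ∈ Hom(M, M((z)))`, `v₍ₙ₎ = (Y v)[[n]]`. The field `borcherds` is the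
coefficient of `z₁⁻ᵐ⁻¹ z₂⁻ᵏ⁻¹` in
`ι_{z₁,z₂}(z₁-z₂)ⁿ Y(v,z₁)Y(u,z₂) - ι_{z₂,z₁}(z₁-z₂)ⁿ Y(u,z₂)Y(v,z₁)
  = ∑ᵢ Y(v₍ₙ₊ᵢ₎u, z₂) ∂⁽ⁱ⁾_{z₂}δ(z₁,z₂)`;
all its sums are finite. -/
structure VirModule (c : ℂ) (M : Type*) [AddCommGroup M] [Module ℂ M] where
  /-- The translation operator. -/
  T : Module.End ℂ M
  /-- The state-field correspondence. -/
  Y : VirC c →ₗ[ℂ] VertexOperator ℂ M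
  Y_vac : ∀ (n : ℤ) (w : M), ((Y (VirC.vac c))[[n]]) w = if n = -1 then w else 0
  T_comm : ∀ (v : VirC c) (n : ℤ) (w : M),
    T (((Y v)[[n]]) w) - ((Y v)[[n]]) (T w) = (-(n : ℂ)) • ((Y v)[[n - 1]]) w
  borcherds : ∀ (v u : VirC c) (n m k : ℤ) (w : M),
    (∑ᶠ j : ℕ, signedChoose n j • ((Y v)[[m + n - j]]) (((Y u)[[k + j]]) w)) -
      (-1 : ℂ) ^ n • (∑ᶠ j : ℕ, signedChoose n j • ((Y u)[[n + k - j]]) (((Y v)[[m + j]]) w)) =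
    ∑ᶠ j : ℕ, ((Ring.choose m j : ℤ) : ℂ) •
      ((Y (((VirC.Y c v)[[n + j]]) u))[[m + k - j]]) w

namespace VirModule

variable {c : ℂ} {M : Type*} [AddCommGroup M] [Module ℂ M] (X : VirModule c M)

/-- The operator `Lₙ = L₍ₙ₊₁₎` on a `Virᶜ`-module. -/
def opL (n : ℤ) : Module.End ℂ M := (X.Y (VirC.conf c))[[n + 1]]

/-- The `λ`-bracket `[v_λ a] = ∑_{n ≥ 0} λⁿ/n! v₍ₙ₎a ∈ M[λ]`. -/
def lambdaBracket (v : VirC c) (a : M) : PolynomialModule ℂ M :=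
  PolynomialModule.ofCoeff ℂ <|
    Finsupp.ofSupportFinite (fun n : ℕ => ((n.factorial : ℂ)⁻¹) • ((X.Y v)[[(n : ℤ)]]) a) <| by
      obtain ⟨N, hN⟩ := exists_ncoeff_eq_zero (X.Y v) a
      refine (Set.finite_lt_nat N).subset fun n hn => ?_
      by_contra hc
      have hc' : N ≤ n := not_lt.1 hc
      exact hn (by simp only [hN n (by exact_mod_cast hc'), smul_zero])

/-- `a` is a primary vector of weight `h`: `[L_λ a] = (T + hλ)a`. Equivalently (`isPrimary_iff`),
`Lₙa = 0` for `n > 0`, `L₀a = ha` and `L₋₁a = Ta`. -/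
def IsPrimary (h : ℂ) (a : M) : Prop :=
  X.lambdaBracket (VirC.conf c) a =
    PolynomialModule.single ℂ 0 (X.T a) + PolynomialModule.single ℂ 1 (h • a)

theorem isPrimary_iff (h : ℂ) (a : M) : X.IsPrimary h a ↔
    (∀ n : ℤ, 0 < n → X.opL n a = 0) ∧ X.opL 0 a = h • a ∧ X.opL (-1) a = X.T a := by
  have key : X.IsPrimary h a ↔ ∀ n : ℕ, ((n.factorial : ℂ)⁻¹) • X.opL (n - 1) a =
      (if n = 0 then X.T a else 0) + (if n = 1 then h • a else 0) := by
    unfold IsPrimary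
    rw [← PolynomialModule.coeff_inj, Finsupp.ext_iff]
    refine forall_congr' fun n => ?_
    simp only [PolynomialModule.coeff_add, PolynomialModule.coeff_single, Finsupp.add_apply,
      Finsupp.single_apply, eq_comm (a := n)]
    have : (X.lambdaBracket (VirC.conf c) a).coeff n =
        ((n.factorial : ℂ)⁻¹) • X.opL (n - 1) a := by
      rw [opL, sub_add_cancel]; rfl
    rw [this]
  rw [key]
  constructor
  · intro H
    refine ⟨fun n hn => ?_, ?_, ?_⟩
    · obtain ⟨p, hp⟩ := Int.eq_ofNat_of_zero_le (show 0 ≤ n - 1 by omega)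
      have := H (p + 2)
      rw [if_neg (by omega), if_neg (by omega), add_zero, smul_eq_zero, or_iff_right
        (inv_ne_zero (by exact_mod_cast Nat.factorial_ne_zero _))] at this
      rw [← this]; congr 1; congr 1; push_cast; omega
    · simpa using H 1
    · simpa using H 0
  · rintro ⟨H2, H1, H0⟩ n
    rcases n with _ | _ | n
    · simpa using H0
    · simpa using H1
    · rw [H2 _ (by push_cast; omega)]; simp

end VirModule

/-- `Γ ⊆ ℂ` with `Γ + ℤ = Γ` and `Γ/ℤ` a finite subset of `ℂ/ℤ`. -/
def IsExponentSet (Γ : Set ℂ) : Prop :=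
  (∀ x ∈ Γ, ∀ n : ℤ, x + n ∈ Γ) ∧
    ((fun x : ℂ => (x : ℂ ⧸ AddSubgroup.zmultiples (1 : ℂ))) '' Γ).Finite

/-- The space `M⟦z⟧z^{-Γ}` of the infinite sums `∑ fₛ zˢ`, where `s` runs over the union of finitely
many sets `-d + ℤ_{≥0}` with `d ∈ Γ`. -/
def genSeries (Γ : Set ℂ) (M : Type*) [AddCommGroup M] [Module ℂ M] : Submodule ℂ (ℂ → M) where
  carrier := {f | ∃ D : Finset ℂ, (D : Set ℂ) ⊆ Γ ∧
    ∀ s, f s ≠ 0 → ∃ d ∈ D, ∃ n : ℕ, s = -d + n}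
  zero_mem' := ⟨∅, by simp, by simp⟩
  add_mem' := by
    classical
    rintro f g ⟨D, hD, hf⟩ ⟨E, hE, hg⟩
    refine ⟨D ∪ E, by simp [hD, hE], fun s hs => ?_⟩
    by_cases h : f s = 0
    · have : g s ≠ 0 := fun h' => hs (by simp [h, h'])
      obtain ⟨d, hd, n, hn⟩ := hg s this
      exact ⟨d, Finset.mem_union_right _ hd, n, hn⟩
    · obtain ⟨d, hd, n, hn⟩ := hf s h
      exact ⟨d, Finset.mem_union_left _ hd, n, hn⟩
  smul_mem' := by
    rintro r f ⟨D, hD, hf⟩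
    exact ⟨D, hD, fun s hs => hf s fun h => hs (by simp [h])⟩

variable {c : ℂ} {M₁ M₂ M₃ : Type*} [AddCommGroup M₁] [Module ℂ M₁] [AddCommGroup M₂] [Module ℂ M₂]
  [AddCommGroup M₃] [Module ℂ M₃]

/-- The mode `a₍ₖ₎b`, `k ∈ ℂ`: the coefficient of `z⁻ᵏ⁻¹` in `𝒴(a, z)b`. -/
def genMode {Γ : Set ℂ} (𝒴 : M₁ →ₗ[ℂ] M₂ →ₗ[ℂ] genSeries Γ M₃) (k : ℂ) (a : M₁) (b : M₂) : M₃ :=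
  (𝒴 a b : ℂ → M₃) (-k - 1)

/-- An intertwining operator of type `(M₃ over M₁ M₂)` between `Virᶜ`-modules, with exponents in
`Γ`. The field `translation` is `[T, 𝒴(a,z)] = 𝒴(Ta,z)`, the field `derivative` is
`𝒴(Ta,z) = ∂_z 𝒴(a,z)`, and `borcherds` is the coefficient of `z₁⁻ᵐ⁻¹ z₂⁻ᵏ⁻¹`, `m ∈ ℤ`, `k ∈ ℂ`, in
`ι_{z₁,z₂}(z₁-z₂)ⁿ Y(v,z₁)𝒴(a,z₂) - ι_{z₂,z₁}(z₁-z₂)ⁿ 𝒴(a,z₂)Y(v,z₁)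
  = ∑ᵢ 𝒴(v₍ₙ₊ᵢ₎a, z₂) ∂⁽ⁱ⁾_{z₂}δ(z₁,z₂)`;
all its sums are finite. -/
structure Intertwiner (X₁ : VirModule c M₁) (X₂ : VirModule c M₂) (X₃ : VirModule c M₃)
    (Γ : Set ℂ) where
  /-- The map `a ↦ 𝒴(a, z)`. -/
  Y : M₁ →ₗ[ℂ] M₂ →ₗ[ℂ] genSeries Γ M₃
  translation : ∀ (a : M₁) (b : M₂) (k : ℂ),
    X₃.T (genMode Y k a b) - genMode Y k a (X₂.T b) = genMode Y k (X₁.T a) b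
  derivative : ∀ (a : M₁) (b : M₂) (k : ℂ), genMode Y k (X₁.T a) b = (-k) • genMode Y (k - 1) a b
  borcherds : ∀ (v : VirC c) (a : M₁) (b : M₂) (n m : ℤ) (k : ℂ),
    (∑ᶠ j : ℕ, signedChoose n j • ((X₃.Y v)[[m + n - j]]) (genMode Y (k + j) a b)) -
      (-1 : ℂ) ^ n •
        (∑ᶠ j : ℕ, signedChoose n j • genMode Y (n + k - j) a (((X₂.Y v)[[m + j]]) b)) =
    ∑ᶠ j : ℕ, ((Ring.choose m j : ℤ) : ℂ) •
      genMode Y (m + k - j) (((X₁.Y v)[[n + j]]) a) b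

namespace Intertwiner

variable {X₁ : VirModule c M₁} {X₂ : VirModule c M₂} {X₃ : VirModule c M₃} {Γ : Set ℂ}

/-- The mode `a₍ₖ₎b` of an intertwining operator. -/
def mode (I : Intertwiner X₁ X₂ X₃ Γ) (k : ℂ) (a : M₁) (b : M₂) : M₃ := genMode I.Y k a b

/-- `S = {m₁, …, m_d}` is a set of leading exponents of `𝒴(a,z)b`: the `mᵢ` lie in different classes
modulo `ℤ` and `𝒴(a,z)b = ∑ᵢ ∑_{n ≥ 0} a₍ₘᵢ₋ₙ₎b z^{-mᵢ+n-1}`. -/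
structure IsLeadingExponents (I : Intertwiner X₁ X₂ X₃ Γ) (a : M₁) (b : M₂) (S : Finset ℂ) :
    Prop where
  incongruent : ∀ m ∈ S, ∀ m' ∈ S, (∃ n : ℤ, m - m' = n) → m = m'
  expansion : ∀ k : ℂ, I.mode k a b ≠ 0 → ∃ m ∈ S, ∃ n : ℕ, k = m - n

end Intertwiner

end Modules

end

/-! The whole argument is the commutator of the Virasoro modes with the modes of `𝒴(a, z)`, read at
an extreme exponent. The Borcherds identity with `n = 0` expresses the commutator of `v₍ₘ₎` with
`a₍ₖ₎` through the vectors `v₍ⱼ₎a`, `j ≥ 0` (`commutator`). For `v = L` and `a` primary only `L₍₀₎a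
= L₋₁a = Ta` and `L₍₁₎a = L₀a = h_a a` survive, so the sum has two terms (`opL_mode`). Since `𝒴(Ta,
z) = ∂_z 𝒴(a, z)`, the term in `Ta` is also a multiple of a mode of `a`, and the result is
`Lₙ(a₍ₖ₎b) = a₍ₖ₎(Lₙb) + ((n + 1)(h_a - 1) - k) a₍ₙ₊ₖ₎b`.

Put `k = m` with `m` a leading exponent. For `n > 0` the first term vanishes because `b` is primary,
and the second because `a₍ₙ₊ₘ₎b` lies beyond the leading exponent of its class modulo `ℤ`
(`IsLeadingExponents.mode_add_eq_zero`). For `n = 0` both terms are multiples of `a₍ₘ₎b`, and the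
eigenvalue is `h_b + h_a - 1 - m = h_c`. For `n = -1` the formula before the elimination of `Ta`
reads `L₋₁(a₍ₘ₎b) = a₍ₘ₎(Tb) + (Ta)₍ₘ₎b`, which is `T(a₍ₘ₎b)` because `T` acts as a derivation of
`𝒴`; this case holds for every exponent. By `isPrimary_iff` the three cases together are the
`λ`-bracket identity.

The condition on `L₋₁` is needed as a separate hypothesis on `a` and `b`, since `T` is not assumed
to equal `L₋₁` on the modules. -/

namespace Intertwiner

open scoped VertexOperator

variable {c : ℂ} {M₁ M₂ M₃ : Type*} [AddCommGroup M₁] [Module ℂ M₁] [AddCommGroup M₂] [Module ℂ M₂]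
  [AddCommGroup M₃] [Module ℂ M₃] {X₁ : VirModule c M₁} {X₂ : VirModule c M₂} {X₃ : VirModule c M₃}
  {Γ : Set ℂ} (I : Intertwiner X₁ X₂ X₃ Γ)

/-! ### Commutators of Virasoro modes with the modes of an intertwining operator -/

/-- The commutator formula
`v₍ₘ₎(a₍ₖ₎b) - a₍ₖ₎(v₍ₘ₎b) = ∑ⱼ (m choose j) (v₍ⱼ₎a)₍ₘ₊ₖ₋ⱼ₎b`. -/
theorem commutator (v : VirC c) (a : M₁) (b : M₂) (m : ℤ) (k : ℂ) :
    ((X₃.Y v)[[m]]) (I.mode k a b) - I.mode k a (((X₂.Y v)[[m]]) b) =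
      ∑ᶠ j : ℕ, ((Ring.choose m j : ℤ) : ℂ) •
        I.mode (m + k - j) (((X₁.Y v)[[(j : ℤ)]]) a) b := by
  -- For `n = 0` the factor `(z₁ - z₂)ⁿ` is `1`, so both of its expansions are trivial: each sum on
  -- the left keeps only its term `j = 0`, while the sum on the right is untouched.
  have h := I.borcherds v a b 0 m k
  rw [finsum_eq_single _ 0, finsum_eq_single _ 0] at h
  · simpa [signedChoose_zero_right, mode] using h
  · intro j hj; rw [signedChoose_zero_left, if_neg hj, zero_smul]
  · intro j hj; rw [signedChoose_zero_left, if_neg hj, zero_smul]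

theorem mode_smul_left (k r : ℂ) (a : M₁) (b : M₂) : I.mode k (r • a) b = r • I.mode k a b := by
  simp [mode, genMode]

theorem mode_zero_left (k : ℂ) (b : M₂) : I.mode k 0 b = 0 := by
  simp [mode, genMode]

theorem mode_smul_right (k r : ℂ) (a : M₁) (b : M₂) : I.mode k a (r • b) = r • I.mode k a b := by
  simp [mode, genMode]

theorem mode_zero_right (k : ℂ) (a : M₁) : I.mode k a 0 = 0 := by
  simp [mode, genMode]

/-- For `a` primary of weight `h`,
`Lₙ(a₍ₖ₎b) = a₍ₖ₎(Lₙb) + (Ta)₍ₙ₊₁₊ₖ₎b + (n + 1)h a₍ₙ₊ₖ₎b`. -/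
theorem opL_mode {h : ℂ} {a : M₁} (ha : X₁.IsPrimary h a) (b : M₂) (n : ℤ) (k : ℂ) :
    X₃.opL n (I.mode k a b) = I.mode k a (X₂.opL n b) + I.mode (n + 1 + k) (X₁.T a) b +
      (((n : ℂ) + 1) * h) • I.mode (n + k) a b := by
  obtain ⟨h₂, h₁, h₀⟩ := (X₁.isPrimary_iff h a).1 ha
  -- The shift `Lₙ = L₍ₙ₊₁₎` turns the conditions on `L₋₁a` and `L₀a` into values of `L₍₀₎a` and
  -- `L₍₁₎a`. The indices are kept as casts from `ℕ` to match the terms of the commutator sum.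
  have h₀' : ((X₁.Y (VirC.conf c))[[((0 : ℕ) : ℤ)]]) a = X₁.T a := by
    simpa [VirModule.opL] using h₀
  have h₁' : ((X₁.Y (VirC.conf c))[[((1 : ℕ) : ℤ)]]) a = h • a := by
    simpa [VirModule.opL] using h₁
  -- The mode index is `n + 1` because `Lₙ = L₍ₙ₊₁₎`. The binomial coefficients of the two surviving
  -- terms are `1` and `n + 1`.
  have hc := I.commutator (VirC.conf c) a b (n + 1) k
  rw [finsum_nat_eq_sum 2, Finset.sum_range_succ, Finset.sum_range_one, sub_eq_iff_eq_add'] at hc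
  · rw [VirModule.opL, VirModule.opL, hc, add_assoc, h₀', h₁',
      mode_smul_left, Ring.choose_zero_right, Ring.choose_one_right, smul_smul]
    push_cast
    rw [one_smul, sub_zero, show (n : ℂ) + 1 + k - 1 = n + k by ring]
  · intro j hj
    -- For `j ≥ 2` one has `L₍ⱼ₎a = Lⱼ₋₁a` with `j - 1 > 0`, which is zero as `a` is primary; this
    -- justifies cutting the sum at `2`.
    have := h₂ (j - 1) (by omega)
    rw [VirModule.opL, sub_add_cancel] at this
    rw [this, mode_zero_left, smul_zero]

/-! ### Leading modes -/

/-- A nonzero mode `a₍ₙ₊ₘ₎b` would have its index at or below some `m' ∈ S` in the same class modulo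
`ℤ`. Incongruence forces `m' = m`, and an index `m + n` with `n > 0` is not at or below `m`. Only
this bound on the exponents is used: the mode `a₍ₘ₎b` itself may be zero. -/
theorem IsLeadingExponents.mode_add_eq_zero {I : Intertwiner X₁ X₂ X₃ Γ} {a : M₁} {b : M₂}
    {S : Finset ℂ} (hS : I.IsLeadingExponents a b S) {m : ℂ} (hm : m ∈ S) {n : ℤ} (hn : 0 < n) :
    I.mode (n + m) a b = 0 := by
  by_contra hne
  obtain ⟨m', hm', p, hp⟩ := hS.expansion _ hne
  -- From `n + m = m' - p` the difference `m' - m` is the integer `n + p`. Once `m' = m` this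
  -- integer is zero, against `n > 0` and `p ≥ 0`.
  obtain rfl := hS.incongruent m' hm' m hm ⟨n + p, by push_cast; linear_combination -hp⟩
  have : ((n + p : ℤ) : ℂ) = 0 := by push_cast; linear_combination hp
  have := Int.cast_eq_zero.1 this
  omega

/-- The leading modes of two primary vectors are primary. -/
theorem IsLeadingExponents.isPrimary_mode {I : Intertwiner X₁ X₂ X₃ Γ} {a : M₁} {b : M₂}
    {S : Finset ℂ} (hS : I.IsLeadingExponents a b S) {m : ℂ} (hm : m ∈ S) {h_a h_b : ℂ}
    (ha : X₁.IsPrimary h_a a) (hb : X₂.IsPrimary h_b b) :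
    X₃.IsPrimary (h_a + h_b - 1 - m) (I.mode m a b) := by
  obtain ⟨hb₂, hb₁, hb₀⟩ := (X₂.isPrimary_iff h_b b).1 hb
  have hT : ∀ k, I.mode k (X₁.T a) b = (-k) • I.mode (k - 1) a b := I.derivative a b
  refine (X₃.isPrimary_iff _ _).2 ⟨fun n hn => ?_, ?_, ?_⟩
  -- Case `n > 0`: differentiation lowers the index of `(Ta)₍ₙ₊₁₊ₘ₎b` by one, so both remaining
  -- terms are multiples of `a₍ₙ₊ₘ₎b`, which vanishes.
  · rw [I.opL_mode ha, hb₂ n hn, mode_zero_right, hT,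
      show (n : ℂ) + 1 + m - 1 = n + m by ring, hS.mode_add_eq_zero hm hn]
    simp
  -- Case `n = 0`: the contributions to the eigenvalue are `h_b` from `L₀b`, `-(1 + m)` from the
  -- derivative and `h_a` from `L₀a`.
  · rw [I.opL_mode ha, hb₁, mode_smul_right, hT, Int.cast_zero, zero_add, zero_add,
      show 1 + m - 1 = m by ring, ← add_smul, ← add_smul]
    congr 1; ring
  -- Case `n = -1`: the coefficient `(n + 1)h_a` is zero, and what remains is the Leibniz rule for
  -- `T`. Here `Ta` is not rewritten as a derivative.
  · rw [I.opL_mode ha, hb₀]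
    have := I.translation a b m
    rw [sub_eq_iff_eq_add'] at this
    simpa [mode] using this.symm

end Intertwiner


/-- The relation between `m` and `h_c` only renames the weight `h_a + h_b - 1 - m` found for the
leading mode. The statements on `Lₙ` and `L₀` are then read off from `isPrimary_iff`. -/
theorem lemma4p1 (c : ℂ)
    {M₁ M₂ M₃ : Type*} [AddCommGroup M₁] [Module ℂ M₁] [AddCommGroup M₂] [Module ℂ M₂]
    [AddCommGroup M₃] [Module ℂ M₃]
    (X₁ : VirModule c M₁) (X₂ : VirModule c M₂) (X₃ : VirModule c M₃)
    (Γ : Set ℂ) (hΓ : IsExponentSet Γ) (I : Intertwiner X₁ X₂ X₃ Γ)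
    (a : M₁) (b : M₂) (h_a h_b : ℂ) (ha : X₁.IsPrimary h_a a) (hb : X₂.IsPrimary h_b b)
    (S : Finset ℂ) (hS : I.IsLeadingExponents a b S) (m : ℂ) (hmS : m ∈ S)
    (h_c : ℂ) (hm : m = h_a + h_b - 1 - h_c) :
    X₃.lambdaBracket (VirC.conf c) (I.mode m a b) =
        PolynomialModule.single ℂ 1 (h_c • I.mode m a b) +
          PolynomialModule.single ℂ 0 (X₃.T (I.mode m a b)) ∧
      X₃.IsPrimary h_c (I.mode m a b) ∧
      (∀ n : ℤ, 0 < n → X₃.opL n (I.mode m a b) = 0) ∧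
      X₃.opL 0 (I.mode m a b) = h_c • I.mode m a b := by
  subst hm
  have h := hS.isPrimary_mode hmS ha hb
  rw [show h_a + h_b - 1 - (h_a + h_b - 1 - h_c) = h_c by ring] at h
  obtain ⟨h₂, h₁, -⟩ := (X₃.isPrimary_iff _ _).1 h
  -- The displayed bracket `λh_c + T` differs from the definition of `IsPrimary` only in the order
  -- of its two summands.
  exact ⟨h.trans (add_comm _ _), h, h₂, h₁⟩
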